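/- **Setting.** Let $F\subseteq\mathbb R$, $0<\alpha\le 1$, $l\in\mathbb R$. For a subdivision $P=\{x=t_0<\dots<t_n=y\}$ of $[x,y]$ put $\sigma^\alpha[F,P]=\sum_{i<n}\frac{(t_{i+1}-t_i)^\alpha}{\Gamma(\alpha+1)}\Theta(F,[t_i,t_{i+1}])$, where $\Theta(F,I)=1$ if $F\cap I\ne\emptyset$ and $0$ otherwise. Let $\gamma^\alpha(F,x,y)=\lim_{\delta\to0^+}\inf\{\sigma^\alpha[F,P]:\max_i(t_{i+1}-t_i)\le\delta\}$, and let $S=S_F^\alpha$ be the integral staircase function, $S(x)=\gamma^\alpha(F,l,x)$ for $x\ge l$ and $S(x)=-\gamma^\alpha(F,x,l)$ for $x<l$. Assume that $\gamma^\alpha(F,x,y)<\infty$ for all $x\le y$, that $S(0)=0$, and that $S(t)\to\infty$ as $t\to\infty$. For $f$ bounded on $F\cap[x,y]$, the integral $\int_x^y f\,d_F^\alpha t$ is the common value, if they agree, of the supremum over subdivisions of $\sum_i\inf_{F\cap[t_i,t_{i+1}]}f\,\cdot(S(t_{i+1})-S(t_i))$ and the infimum of $\sum_i\sup_{F\cap[t_i,t_{i+1}]}f\,\cdot(S(t_{i+1})-S(t_i))$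 (an infimum or supremum over the empty set counts as $0$), and $\int_0^\infty f\,d_F^\alpha t=\lim_{b\to\infty}\int_0^b f\,d_F^\alpha t$. The fractal Sumudu transform of $f$ at $v$ is $$\mathscr S[f](v)=\frac1{S(v)}\int_0^\infty e^{-S(t)/S(v)}f(t)\,d_F^\alpha t,$$ if the integral exists. For $\beta>0$ and $a\in\mathbb R$ the fractal Mittag-Leffler function of order $\beta$ gives $$E_F^\alpha(-at^\beta)=\sum_{j=0}^\infty\frac{(-a\,S(t)^\beta)^j}{\Gamma_F^\alpha(\beta j+1)},\qquad \Gamma_F^\alpha(s)=\int_0^\infty e^{-S(t)}S(t)^{s-1}\,d_F^\alpha t,$$ where $s$ is the staircase value of the argument of the fractal Gamma function. **Lemma.** Let $\beta>0$, $a\in\mathbb R$, and let $v$ satisfy $S(v)>0$. (i) If $\mathscr S[E_F^\alpha(-at^\beta)](v)$ exists, then $1+aS(v)^\beta\ne0$ and $$\mathscr S\big[E_F^\alpha(-at^\beta)\big](v)=\frac1{1+a\,S(v)^\beta}.$$ (ii) If $\mathscr S[1-E_F^\alpha(-at^\beta)](v)$ exists, then $1+aS(v)^\beta\ne0$ and $$\mathscr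 S\big[1-E_F^\alpha(-at^\beta)\big](v)=\frac{a\,S(v)^\beta}{1+a\,S(v)^\beta}.$$ Both transforms exist if $|a|\,S(v)^\beta<1$, and, when $a\ge0$ and $\beta\le1$, for every $v$ with $S(v)>0$. -/

import Mathlib

open Filter Topology
open scoped ENNReal

/-- A subdivision `x = t₀ < t₁ < ⋯ < tₙ = y` of the interval `[x, y]`
(only the values `pt 0, …, pt n` matter). -/
structure Subdivision (x y : ℝ) where
  n : ℕ
  pt : ℕ → ℝ
  pt_zero : pt 0 = x
  pt_last : pt n = y
  lt_succ : ∀ i < n, pt i < pt (i + 1)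

/-- `|P| ≤ δ`: every interval of the subdivision has length at most `δ`. -/
def Subdivision.MeshLE {x y : ℝ} (P : Subdivision x y) (δ : ℝ) : Prop :=
  ∀ i < P.n, P.pt (i + 1) - P.pt i ≤ δ

open Classical in
/-- The flag function `Θ(F, I)`: `1` if `F ∩ I` is non-empty, and `0` otherwise. -/
noncomputable def flag (F I : Set ℝ) : ℝ :=
  if (F ∩ I).Nonempty then 1 else 0

/-- `σ^α[F, P] = ∑ (t_{i+1} - t_i)^α / Γ(α + 1) * Θ(F, [t_i, t_{i+1}])`.
It is `0` when `x = y`, the sum being empty then. -/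
noncomputable def Subdivision.sigma {x y : ℝ} (P : Subdivision x y) (F : Set ℝ) (α : ℝ) : ℝ :=
  ∑ i ∈ Finset.range P.n,
    (P.pt (i + 1) - P.pt i) ^ α / Real.Gamma (α + 1) * flag F (Set.Icc (P.pt i) (P.pt (i + 1)))

/-- The coarse-grained mass `γ_δ^α(F, x, y)`, for `x ≤ y`. -/
noncomputable def coarseMass (F : Set ℝ) (α δ x y : ℝ) : ℝ≥0∞ :=
  ⨅ (P : Subdivision x y) (_ : P.MeshLE δ), ENNReal.ofReal (P.sigma F α)

/-- The mass function `γ^α(F, x, y)`, for `x ≤ y`: the limit of `γ_δ^α(F, x, y)` as `δ` decreases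
to `0` (see `tendsto_coarseMass`). The value `∞` is possible. -/
noncomputable def massFunction (F : Set ℝ) (α x y : ℝ) : ℝ≥0∞ :=
  ⨆ (δ : ℝ) (_ : 0 < δ), coarseMass F α δ x y

theorem tendsto_coarseMass (F : Set ℝ) (α x y : ℝ) :
    Tendsto (fun δ => coarseMass F α δ x y) (𝓝[>] 0) (𝓝 (massFunction F α x y)) := by
  have hanti : Antitone (fun δ => coarseMass F α δ x y) := by
    intro δ₁ δ₂ h
    refine iInf_mono fun P => ?_
    exact iInf_mono' fun hP => ⟨fun i hi => (hP i hi).trans h, le_rfl⟩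
  have := hanti.tendsto_nhdsGT 0
  rwa [sSup_image] at this

open Classical in
/-- The integral staircase function `S_F^α` of order `α` with base point `l`. -/
noncomputable def staircase (F : Set ℝ) (α l x : ℝ) : ℝ :=
  if l ≤ x then (massFunction F α l x).toReal else -(massFunction F α x l).toReal

/-- The upper `F^α`-sum of `f`. The supremum is over `F ∩ [t_i, t_{i+1}]`, and it counts as `0`
where that set is empty (the supremum of the empty set of reals is `0` in Mathlib). -/
noncomputable def Subdivision.upperSum {x y : ℝ} (P : Subdivision x y) (F : Set ℝ) (α l : ℝ)
    (f : ℝ → ℝ) : ℝ :=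
  ∑ i ∈ Finset.range P.n,
    sSup (f '' (F ∩ Set.Icc (P.pt i) (P.pt (i + 1)))) *
      (staircase F α l (P.pt (i + 1)) - staircase F α l (P.pt i))

/-- The lower `F^α`-sum of `f`, with the same convention. -/
noncomputable def Subdivision.lowerSum {x y : ℝ} (P : Subdivision x y) (F : Set ℝ) (α l : ℝ)
    (f : ℝ → ℝ) : ℝ :=
  ∑ i ∈ Finset.range P.n,
    sInf (f '' (F ∩ Set.Icc (P.pt i) (P.pt (i + 1)))) *
      (staircase F α l (P.pt (i + 1)) - staircase F α l (P.pt i))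

/-- `f` is `F^α`-integrable on `[x, y]` with `∫_x^y f(t) d_F^α t = I`: `f` is bounded on
`F ∩ [x, y]`, and its lower integral (the supremum of the lower sums) and its upper integral
(the infimum of the upper sums) both equal `I`. -/
def HasFractalIntegral (F : Set ℝ) (α l : ℝ) (f : ℝ → ℝ) (x y I : ℝ) : Prop :=
  BddAbove (f '' (F ∩ Set.Icc x y)) ∧ BddBelow (f '' (F ∩ Set.Icc x y)) ∧
    IsLUB (Set.range fun P : Subdivision x y => P.lowerSum F α l f) I ∧
    IsGLB (Set.range fun P : Subdivision x y => P.upperSum F α l f) I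

/-- `∫_0^∞ f(t) d_F^α t` exists and equals `I`, as the limit of `∫_0^b f(t) d_F^α t` when
`b → ∞`. -/
def HasFractalImproperIntegral (F : Set ℝ) (α l : ℝ) (f : ℝ → ℝ) (I : ℝ) : Prop :=
  ∃ G : ℝ → ℝ, (∀ b, 0 ≤ b → HasFractalIntegral F α l f 0 b (G b)) ∧ Tendsto G atTop (𝓝 I)

open Classical in
/-- The value of `∫_0^∞ f(t) d_F^α t` (and `0` if the integral does not exist). -/
noncomputable def fractalImproperIntegral (F : Set ℝ) (α l : ℝ) (f : ℝ → ℝ) : ℝ :=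
  if h : ∃ I, HasFractalImproperIntegral F α l f I then h.choose else 0

/-- The fractal Gamma function `∫_0^∞ e^{-S(t)} S(t)^{s - 1} d_F^α t`, with `S = S_F^α`, as a
function of the staircase value `s` of its argument. It is used for `s ≥ 1` only, where the
integrand is bounded on bounded intervals. -/
noncomputable def fractalGamma (F : Set ℝ) (α l s : ℝ) : ℝ :=
  fractalImproperIntegral F α l fun t =>
    Real.exp (-staircase F α l t) * staircase F α l t ^ (s - 1)

/-- The fractal Mittag-Leffler series `∑_j z^j / Γ_F^α(η j + ν)` as a function of the staircase
value `z` of its argument. -/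
noncomputable def fractalMittagLeffler (F : Set ℝ) (α l η ν z : ℝ) : ℝ :=
  ∑' j : ℕ, z ^ j / fractalGamma F α l (η * j + ν)

/-- The function `t ↦ E_F^α(-a t^β)`, that is, the fractal Mittag-Leffler function of order `β`
(parameters `η = β`, `ν = 1`) at the staircase value `-a S_F^α(t)^β`. -/
noncomputable def mittagLefflerNegPow (F : Set ℝ) (α l a β t : ℝ) : ℝ :=
  fractalMittagLeffler F α l β 1 (-a * staircase F α l t ^ β)

/-- The fractal Sumudu transform of `f` at `v`, namely
`(1 / S(v)) ∫_0^∞ e^{-S(t) / S(v)} f(t) d_F^α t` with `S = S_F^α`, exists and equals `c`. -/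
def HasFractalSumudu (F : Set ℝ) (α l : ℝ) (f : ℝ → ℝ) (v c : ℝ) : Prop :=
  ∃ I, HasFractalImproperIntegral F α l
      (fun t => Real.exp (-(staircase F α l t / staircase F α l v)) * f t) I ∧
    c = 1 / staircase F α l v * I

/-! The staircase `S` is monotone and continuous, and it grows only where it meets `F`. The
substitution `u = S(t)` therefore turns the `F^α`-integral of `g ∘ S`, `g` continuous, into the
ordinary integral of `g` (`hasFractalIntegral_comp_staircase`). Since `S(0) = 0` and `S → ∞`,
improper integrals correspond as well, the fractal Gamma function is the classical one on `[1, ∞)`,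
and everything reduces to the limit of `Y(X) = ∫_0^X e^{-x} E_β(-λ x^β) dx` with `λ = a S(v)^β`.

That limit cannot be found by integrating the series term by term, since the result `∑ (-λ)^j` may
diverge. Instead, `E_β(-λ x^β)` solves a Volterra equation (`mittagLeffler_volterra`). Multiplying
by `e^{-x}` and integrating gives the renewal equation `Y(X) = 1 - e^{-X} - λ ∫ k(r) Y((X - r)⁺)
dr`, where `k` is the Gamma probability density (`integral_exp_mul_mittagLeffler`). If `Y → I`,
dominated convergence yields `(1 + λ) I = 1`, even if the convergence is only conditional; this also
forces `1 + λ ≠ 0`.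

Existence: for `|λ| < 1` the renewal equation for `-|λ|` bounds a non-negative majorant; for `λ ≥
0`, `β ≤ 1` the Volterra equation gives `0 < E_β(-λ x^β) ≤ 1`. -/

theorem flag_nonneg (F I : Set ℝ) : 0 ≤ flag F I := by
  unfold flag; split_ifs <;> norm_num

theorem flag_le_one (F I : Set ℝ) : flag F I ≤ 1 := by
  unfold flag; split_ifs <;> norm_num

/-! ### Concatenating, cutting and refining subdivisions. -/

namespace Subdivision

variable {x y z : ℝ}

/-- The subdivision of a degenerate interval. -/
def trivial (x : ℝ) : Subdivision x x where
  n := 0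
  pt _ := x
  pt_zero := rfl
  pt_last := rfl
  lt_succ i hi := absurd hi (Nat.not_lt_zero i)

/-- The subdivision with a single interval. -/
def single (h : x < y) : Subdivision x y where
  n := 1
  pt i := if i = 0 then x else y
  pt_zero := rfl
  pt_last := rfl
  lt_succ i hi := by
    obtain rfl : i = 0 := by omega
    simpa using h

/-- Concatenation of subdivisions of adjacent intervals. -/
def append (P : Subdivision x y) (Q : Subdivision y z) : Subdivision x z where
  n := P.n + Q.n
  pt i := if i < P.n then P.pt i else Q.pt (i - P.n)
  pt_zero := by
    by_cases h : 0 < P.n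
    · simp [h, P.pt_zero]
    · have h0 : P.n = 0 := by omega
      have := P.pt_last
      rw [h0, P.pt_zero] at this
      simp [h0, Q.pt_zero, this]
  pt_last := by simp [Q.pt_last]
  lt_succ i hi := by
    rcases lt_trichotomy (i + 1) P.n with h | h | h
    · have h' : i < P.n := by omega
      simpa [h, h'] using P.lt_succ i h'
    · have h' : i < P.n := by omega
      have := P.lt_succ i h'
      rw [h, P.pt_last] at this
      simpa [h, h', Q.pt_zero] using this
    · have h' : ¬ i < P.n := by omega
      have h'' : ¬ i + 1 < P.n := by omega
      have h3 : i + 1 - P.n = (i - P.n) + 1 := by omega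
      simpa [h', h'', h3] using Q.lt_succ (i - P.n) (by omega)

theorem append_pt_left (P : Subdivision x y) (Q : Subdivision y z) {i : ℕ} (h : i ≤ P.n) :
    (P.append Q).pt i = P.pt i := by
  rcases h.lt_or_eq with h | rfl
  · simp [append, h]
  · simp [append, P.pt_last, Q.pt_zero]

theorem append_pt_right (P : Subdivision x y) (Q : Subdivision y z) (i : ℕ) :
    (P.append Q).pt (P.n + i) = Q.pt i := by
  simp [append]

theorem append_n (P : Subdivision x y) (Q : Subdivision y z) :
    (P.append Q).n = P.n + Q.n := rfl

theorem MeshLE.append {P : Subdivision x y} {Q : Subdivision y z} {δ : ℝ} (hP : P.MeshLE δ)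
    (hQ : Q.MeshLE δ) : (P.append Q).MeshLE δ := by
  intro i hi
  rw [append_n] at hi
  by_cases h : i < P.n
  · rw [append_pt_left _ _ h, append_pt_left _ _ h.le]
    exact hP i h
  · obtain ⟨j, rfl⟩ := Nat.exists_eq_add_of_le (not_lt.1 h)
    rw [add_assoc, append_pt_right, append_pt_right]
    exact hQ j (by omega)

theorem sigma_append (P : Subdivision x y) (Q : Subdivision y z) (F : Set ℝ) (α : ℝ) :
    (P.append Q).sigma F α = P.sigma F α + Q.sigma F α := by
  unfold sigma
  rw [append_n, Finset.sum_range_add]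
  congr 1
  · refine Finset.sum_congr rfl fun i hi => ?_
    have hi := Finset.mem_range.1 hi
    rw [append_pt_left _ _ hi, append_pt_left _ _ hi.le]
  · refine Finset.sum_congr rfl fun i _ => ?_
    rw [add_assoc, append_pt_right, append_pt_right]

theorem sigma_nonneg (P : Subdivision x y) (F : Set ℝ) {α : ℝ} (hα : 0 < α) :
    0 ≤ P.sigma F α := by
  refine Finset.sum_nonneg fun i hi => mul_nonneg (div_nonneg ?_ ?_) (flag_nonneg _ _)
  · exact Real.rpow_nonneg (sub_nonneg.2 (P.lt_succ i (Finset.mem_range.1 hi)).le) _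
  · exact (Real.Gamma_pos_of_pos (by linarith)).le

/-- The initial segment of a subdivision. -/
def take (P : Subdivision x y) (k : ℕ) (hk : k ≤ P.n) : Subdivision x (P.pt k) where
  n := k
  pt := P.pt
  pt_zero := P.pt_zero
  pt_last := rfl
  lt_succ i hi := P.lt_succ i (hi.trans_le hk)

theorem exists_of_le (h : x ≤ y) {δ : ℝ} (hδ : y - x ≤ δ) (F : Set ℝ) {α : ℝ} (hα : 0 < α) :
    ∃ P : Subdivision x y, P.MeshLE δ ∧
      P.sigma F α ≤ (y - x) ^ α / Real.Gamma (α + 1) * flag F (Set.Icc x y) := by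
  rcases h.lt_or_eq with h | rfl
  · refine ⟨single h, ?_, ?_⟩
    · intro i hi
      obtain rfl : i = 0 := Nat.lt_one_iff.1 hi
      simpa [single] using hδ
    · simp [single, sigma]
  · refine ⟨trivial x, fun i hi => absurd hi (Nat.not_lt_zero i), ?_⟩
    simp [trivial, sigma, hα.ne']

theorem pt_mono (P : Subdivision x y) {i j : ℕ} (hij : i ≤ j) (hj : j ≤ P.n) :
    P.pt i ≤ P.pt j := by
  induction j, hij using Nat.le_induction with
  | base => exact le_rfl
  | succ k _ ih => exact (ih (by omega)).trans (P.lt_succ k (by omega)).le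

theorem pt_mem (P : Subdivision x y) {i : ℕ} (hi : i ≤ P.n) : P.pt i ∈ Set.Icc x y :=
  ⟨by simpa [P.pt_zero] using P.pt_mono (Nat.zero_le i) hi,
   by simpa [P.pt_last] using P.pt_mono hi le_rfl⟩

theorem le (P : Subdivision x y) : x ≤ y := by
  have := P.pt_mem le_rfl
  exact this.1.trans this.2

/-- Only the interval containing `y` has to be cut. Its two halves have length at most `δ`, so each
adds at most `δ^α / Γ(α + 1)`. The induction peels off the last interval. -/
theorem exists_split {δ : ℝ} (hδ : 0 ≤ δ) (F : Set ℝ) {α : ℝ} (hα : 0 < α) (P : Subdivision x z)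
    (hP : P.MeshLE δ) (hxy : x ≤ y) (hyz : y ≤ z) :
    ∃ (Q : Subdivision x y) (R : Subdivision y z), Q.MeshLE δ ∧ R.MeshLE δ ∧
      Q.sigma F α + R.sigma F α ≤ P.sigma F α + 2 * (δ ^ α / Real.Gamma (α + 1)) := by
  have hG : 0 < Real.Gamma (α + 1) := Real.Gamma_pos_of_pos (by linarith)
  have hterm : ∀ s t : ℝ, s ≤ t → t - s ≤ δ →
      (t - s) ^ α / Real.Gamma (α + 1) * flag F (Set.Icc s t) ≤ δ ^ α / Real.Gamma (α + 1) := by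
    intro s t hst h
    have h0 : (0 : ℝ) ≤ t - s := sub_nonneg.2 hst
    have h1 : (t - s) ^ α / Real.Gamma (α + 1) ≤ δ ^ α / Real.Gamma (α + 1) := by gcongr
    have h2 : 0 ≤ (t - s) ^ α / Real.Gamma (α + 1) := by positivity
    exact (mul_le_of_le_one_right h2 (flag_le_one _ _)).trans h1
  generalize hn : P.n = n
  induction n generalizing z with
  | zero =>
    have hzx : z = x := by rw [← P.pt_last, hn, P.pt_zero]
    subst hzx
    obtain rfl : z = y := le_antisymm hxy hyz
    obtain ⟨Q, hQ, hQs⟩ := exists_of_le le_rfl (by simpa using hδ) F hα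
    refine ⟨Q, Q, hQ, hQ, ?_⟩
    rw [sub_self, Real.zero_rpow hα.ne', zero_div, zero_mul] at hQs
    have := P.sigma_nonneg F hα
    have h2 : 0 ≤ δ ^ α / Real.Gamma (α + 1) := by positivity
    linarith
  | succ n ih =>
    have hz : P.pt (n + 1) = z := by rw [← hn, P.pt_last]
    have hlt : P.pt n < z := by simpa only [hz] using P.lt_succ n (by omega)
    have hmesh : z - P.pt n ≤ δ := by simpa only [hz] using hP n (by omega)
    have htake : (P.take n (by omega)).MeshLE δ := fun i hi => hP i (by
      have : i < n := hi
      omega)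
    have hsig : P.sigma F α = (P.take n (by omega)).sigma F α +
        (z - P.pt n) ^ α / Real.Gamma (α + 1) * flag F (Set.Icc (P.pt n) z) := by
      have : P.sigma F α = ∑ i ∈ Finset.range (n + 1),
          (P.pt (i + 1) - P.pt i) ^ α / Real.Gamma (α + 1) *
            flag F (Set.Icc (P.pt i) (P.pt (i + 1))) := by rw [sigma, hn]
      rw [this, Finset.sum_range_succ, hz]
      rfl
    rcases le_total y (P.pt n) with h | h
    · obtain ⟨Q, R, hQ, hR, hs⟩ := ih (P.take n (by omega)) htake h rfl
      obtain ⟨T, hT, hTs⟩ := exists_of_le hlt.le hmesh F hα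
      refine ⟨Q, R.append T, hQ, hR.append hT, ?_⟩
      rw [sigma_append]
      linarith
    · obtain ⟨T, hT, hTs⟩ := exists_of_le h (by linarith : y - P.pt n ≤ δ) F hα
      obtain ⟨R, hR, hRs⟩ := exists_of_le hyz (by linarith : z - y ≤ δ) F hα
      refine ⟨(P.take n (by omega)).append T, R, htake.append hT, hR, ?_⟩
      rw [sigma_append]
      have h1 := hterm _ _ h (by linarith)
      have h2 := hterm _ _ hyz (by linarith)
      have h3 : 0 ≤ (z - P.pt n) ^ α / Real.Gamma (α + 1) * flag F (Set.Icc (P.pt n) z) :=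
        mul_nonneg (div_nonneg (Real.rpow_nonneg (by linarith) _) hG.le) (flag_nonneg _ _)
      linarith

theorem exists_meshLE (h : x ≤ y) {δ : ℝ} (hδ : 0 < δ) : ∃ P : Subdivision x y, P.MeshLE δ := by
  have key : ∀ (n : ℕ) (y : ℝ), x ≤ y → y - x ≤ n * δ → ∃ P : Subdivision x y, P.MeshLE δ := by
    intro n
    induction n with
    | zero =>
      intro y hxy hy
      -- Only the mesh matters here; the set `∅` and the exponent `1` are placeholders.
      obtain ⟨P, hP, _⟩ := exists_of_le hxy (by simp at hy; linarith : y - x ≤ δ) ∅ one_pos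
      exact ⟨P, hP⟩
    | succ n ih =>
      intro y hxy hy
      push_cast at hy
      rcases le_total (y - x) δ with h | h
      · obtain ⟨P, hP, _⟩ := exists_of_le hxy h ∅ one_pos
        exact ⟨P, hP⟩
      · obtain ⟨P, hP⟩ := ih (y - δ) (by linarith) (by linarith)
        obtain ⟨Q, hQ, _⟩ :=
          exists_of_le (by linarith : y - δ ≤ y) (by linarith : y - (y - δ) ≤ δ) ∅ one_pos
        exact ⟨P.append Q, hP.append hQ⟩
  obtain ⟨n, hn⟩ := exists_nat_ge ((y - x) / δ)
  exact key n y h (by rwa [div_le_iff₀ hδ] at hn)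

end Subdivision

/-! ### Additivity and continuity of the mass function. -/

section Mass

variable {F : Set ℝ} {α x y z : ℝ}

theorem coarseMass_le_massFunction {δ : ℝ} (hδ : 0 < δ) :
    coarseMass F α δ x y ≤ massFunction F α x y :=
  le_iSup₂ (f := fun (δ : ℝ) (_ : 0 < δ) => coarseMass F α δ x y) δ hδ

theorem coarseMass_add_le (hα : 0 < α) (δ : ℝ) :
    coarseMass F α δ x z ≤ coarseMass F α δ x y + coarseMass F α δ y z := by
  simp only [coarseMass, ENNReal.iInf_add, ENNReal.add_iInf]
  refine le_iInf₂ fun Q hQ => le_iInf₂ fun P hP => ?_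
  refine (iInf₂_le (P.append Q) (hP.append hQ)).trans ?_
  rw [Subdivision.sigma_append, ENNReal.ofReal_add (P.sigma_nonneg F hα) (Q.sigma_nonneg F hα)]

theorem coarseMass_add_coarseMass_le (hα : 0 < α) {δ : ℝ} (hδ : 0 ≤ δ) (hxy : x ≤ y)
    (hyz : y ≤ z) :
    coarseMass F α δ x y + coarseMass F α δ y z ≤
      coarseMass F α δ x z + ENNReal.ofReal (2 * (δ ^ α / Real.Gamma (α + 1))) := by
  have hG : 0 < Real.Gamma (α + 1) := Real.Gamma_pos_of_pos (by linarith)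
  conv_rhs => simp only [coarseMass, ENNReal.iInf_add]
  refine le_iInf₂ fun P hP => ?_
  obtain ⟨Q, R, hQ, hR, h⟩ := P.exists_split hδ F hα hP hxy hyz
  rw [← ENNReal.ofReal_add (P.sigma_nonneg F hα) (by positivity)]
  refine (add_le_add (iInf₂_le Q hQ) (iInf₂_le R hR)).trans ?_
  rw [← ENNReal.ofReal_add (Q.sigma_nonneg F hα) (R.sigma_nonneg F hα)]
  exact ENNReal.ofReal_le_ofReal h

theorem coarseMass_le_ofReal (hα : 0 < α) {δ : ℝ} (hxy : x ≤ y) (hδ : y - x ≤ δ) :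
    coarseMass F α δ x y ≤
      ENNReal.ofReal ((y - x) ^ α / Real.Gamma (α + 1) * flag F (Set.Icc x y)) := by
  obtain ⟨P, hP, h⟩ := Subdivision.exists_of_le hxy hδ F hα
  exact (iInf₂_le P hP).trans (ENNReal.ofReal_le_ofReal h)

/-- At scale `δ` the coarse mass is subadditive by concatenation, and superadditive up to the
cutting error `2 δ^α / Γ(α + 1)`, which vanishes as `δ → 0` because `α > 0`. -/
theorem massFunction_add (hα : 0 < α) (hxy : x ≤ y) (hyz : y ≤ z) :
    massFunction F α x y + massFunction F α y z = massFunction F α x z := by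
  have hsum : Tendsto (fun δ => coarseMass F α δ x y + coarseMass F α δ y z) (𝓝[>] 0)
      (𝓝 (massFunction F α x y + massFunction F α y z)) :=
    (tendsto_coarseMass F α x y).add (tendsto_coarseMass F α y z)
  refine le_antisymm ?_ ?_
  · have herr : Tendsto (fun δ : ℝ => ENNReal.ofReal (2 * (δ ^ α / Real.Gamma (α + 1))))
        (𝓝[>] 0) (𝓝 0) := by
      have hc : Continuous fun δ : ℝ => 2 * (δ ^ α / Real.Gamma (α + 1)) :=
        continuous_const.mul ((Real.continuous_rpow_const hα.le).div_const _)
      have := (ENNReal.continuous_ofReal.comp hc).tendsto 0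
      simp only [Function.comp_def, Real.zero_rpow hα.ne', zero_div, mul_zero,
        ENNReal.ofReal_zero] at this
      exact this.mono_left nhdsWithin_le_nhds
    have := (tendsto_coarseMass F α x z).add herr
    rw [add_zero] at this
    refine le_of_tendsto_of_tendsto hsum this ?_
    filter_upwards [self_mem_nhdsWithin] with δ hδ
    exact coarseMass_add_coarseMass_le hα (le_of_lt hδ) hxy hyz
  · exact le_of_tendsto_of_tendsto (tendsto_coarseMass F α x z) hsum
      (Eventually.of_forall fun δ => coarseMass_add_le hα δ)

theorem massFunction_eq_zero_of_disjoint (hxy : x ≤ y)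
    (hF : ¬ (F ∩ Set.Icc x y).Nonempty) : massFunction F α x y = 0 := by
  refine le_antisymm (iSup₂_le fun δ hδ => ?_) zero_le
  obtain ⟨P, hP⟩ := Subdivision.exists_meshLE hxy hδ
  refine (iInf₂_le P hP).trans ?_
  have : P.sigma F α = 0 := by
    refine Finset.sum_eq_zero fun i hi => ?_
    have hi := Finset.mem_range.1 hi
    have : ¬ (F ∩ Set.Icc (P.pt i) (P.pt (i + 1))).Nonempty := fun ⟨t, ht, ht'⟩ =>
      hF ⟨t, ht, (P.pt_mem hi.le).1.trans ht'.1, ht'.2.trans (P.pt_mem hi).2⟩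
    simp [flag, this]
  simp [this]

/-- Choose `δ` so small that the coarse mass of `[A, B]` is within `ε / 2` of the mass and `δ^α /
Γ(α + 1) < ε / 2`. Replacing coarse mass by mass on `[A, x]` and `[y, B]`, and bounding the coarse
mass of `[x, y]` by a single interval, leaves `ε` for `[x, y]` once the finite outer masses are
cancelled. -/
theorem exists_massFunction_le (hα : 0 < α) {A B : ℝ} (hAB : massFunction F α A B ≠ ∞)
    {ε : ℝ} (hε : 0 < ε) :
    ∃ δ > 0, ∀ x y, A ≤ x → x ≤ y → y ≤ B → y - x ≤ δ →
      massFunction F α x y ≤ ENNReal.ofReal ε := by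
  have hG : 0 < Real.Gamma (α + 1) := Real.Gamma_pos_of_pos (by linarith)
  have hε2 : ENNReal.ofReal (ε / 2) ≠ 0 := by simpa using hε
  have h1 : ∀ᶠ δ in 𝓝[>] (0 : ℝ),
      massFunction F α A B ≤ coarseMass F α δ A B + ENNReal.ofReal (ε / 2) := by
    by_cases h0 : massFunction F α A B = 0
    · exact Eventually.of_forall fun δ => by simp [h0]
    · have : massFunction F α A B - ENNReal.ofReal (ε / 2) < massFunction F α A B :=
        ENNReal.sub_lt_self hAB h0 hε2
      filter_upwards [(tendsto_coarseMass F α A B).eventually (lt_mem_nhds this)] with δ hδ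
      exact tsub_le_iff_right.1 hδ.le
  have hc : ∀ᶠ δ in 𝓝[>] (0 : ℝ), δ ^ α / Real.Gamma (α + 1) < ε / 2 := by
    have hc : Continuous fun δ : ℝ => δ ^ α / Real.Gamma (α + 1) :=
      (Real.continuous_rpow_const hα.le).div_const _
    have := hc.tendsto 0
    simp only [Real.zero_rpow hα.ne', zero_div] at this
    exact (this.mono_left nhdsWithin_le_nhds).eventually_lt_const (by linarith)
  obtain ⟨δ, ⟨hδ, hδε⟩, hδ0⟩ := ((h1.and hc).and self_mem_nhdsWithin).exists
  have hδ0 : 0 < δ := hδ0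
  refine ⟨δ, hδ0, fun x y hAx hxy hyB hyx => ?_⟩
  have hAB' := massFunction_add (F := F) hα hAx (hxy.trans hyB)
  have hxB := massFunction_add (F := F) hα hxy hyB
  have hfin1 : massFunction F α A x ≠ ∞ := fun h => hAB (by rw [← hAB', h, top_add])
  have hfin2 : massFunction F α y B ≠ ∞ := fun h => hAB (by rw [← hAB', ← hxB, h]; simp)
  have hmid : coarseMass F α δ x y ≤ ENNReal.ofReal (ε / 2) := by
    refine (coarseMass_le_ofReal hα hxy hyx).trans (ENNReal.ofReal_le_ofReal ?_)
    have h0 : (0 : ℝ) ≤ y - x := sub_nonneg.2 hxy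
    have h1 : (y - x) ^ α / Real.Gamma (α + 1) ≤ δ ^ α / Real.Gamma (α + 1) := by gcongr
    have h2 : 0 ≤ (y - x) ^ α / Real.Gamma (α + 1) := by positivity
    exact (mul_le_of_le_one_right h2 (flag_le_one _ _)).trans (h1.trans hδε.le)
  have hle : massFunction F α A x + (massFunction F α x y + massFunction F α y B) ≤
      massFunction F α A x + (ENNReal.ofReal ε + massFunction F α y B) := by
    calc massFunction F α A x + (massFunction F α x y + massFunction F α y B)
        = massFunction F α A B := by rw [hxB, hAB']
      _ ≤ coarseMass F α δ A B + ENNReal.ofReal (ε / 2) := hδ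
      _ ≤ (coarseMass F α δ A x + (coarseMass F α δ x y + coarseMass F α δ y B)) +
            ENNReal.ofReal (ε / 2) := by
          gcongr
          exact (coarseMass_add_le hα δ).trans (by gcongr; exact coarseMass_add_le hα δ)
      _ ≤ (massFunction F α A x + (ENNReal.ofReal (ε / 2) + massFunction F α y B)) +
            ENNReal.ofReal (ε / 2) := by
          gcongr
          · exact coarseMass_le_massFunction hδ0
          · exact coarseMass_le_massFunction hδ0
      _ = massFunction F α A x + ((ENNReal.ofReal (ε / 2) + ENNReal.ofReal (ε / 2)) +
            massFunction F α y B) := by ring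
      _ = _ := by rw [← ENNReal.ofReal_add (by linarith) (by linarith), add_halves]
  rw [ENNReal.add_le_add_iff_left hfin1, ENNReal.add_le_add_iff_right hfin2] at hle
  exact hle

end Mass

/-! ### Monotonicity and continuity of the staircase, and its constancy off `F`. -/

section Staircase

variable {F : Set ℝ} {α l x y : ℝ}

theorem staircase_sub (hα : 0 < α) (hfin : ∀ x y : ℝ, x ≤ y → massFunction F α x y ≠ ∞)
    (hxy : x ≤ y) :
    staircase F α l y - staircase F α l x = (massFunction F α x y).toReal := by
  have hadd : ∀ {a b c : ℝ}, a ≤ b → b ≤ c → (massFunction F α a c).toReal =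
      (massFunction F α a b).toReal + (massFunction F α b c).toReal := by
    intro a b c hab hbc
    rw [← massFunction_add hα hab hbc, ENNReal.toReal_add (hfin _ _ hab) (hfin _ _ hbc)]
  unfold staircase
  by_cases hx : l ≤ x
  · have hy := hx.trans hxy
    rw [if_pos hx, if_pos hy, hadd hx hxy]; ring
  · have hx' := (not_le.1 hx).le
    by_cases hy : l ≤ y
    · rw [if_neg hx, if_pos hy, hadd hx' hy]; ring
    · rw [if_neg hx, if_neg hy, hadd hxy (not_le.1 hy).le]; ring

theorem staircase_mono (hα : 0 < α) (hfin : ∀ x y : ℝ, x ≤ y → massFunction F α x y ≠ ∞) :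
    Monotone (staircase F α l) := fun x y hxy => by
  have := staircase_sub (l := l) hα hfin hxy
  have h0 := (massFunction F α x y).toReal_nonneg
  linarith

theorem staircase_continuous (hα : 0 < α)
    (hfin : ∀ x y : ℝ, x ≤ y → massFunction F α x y ≠ ∞) : Continuous (staircase F α l) := by
  refine Metric.continuous_iff.2 fun x ε hε => ?_
  obtain ⟨δ, hδ, h⟩ := exists_massFunction_le hα (hfin (x - 1) (x + 1) (by linarith))
    (half_pos hε)
  have hbd : ∀ s t, x - 1 ≤ s → s ≤ t → t ≤ x + 1 → t - s ≤ δ →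
      staircase F α l t - staircase F α l s ≤ ε / 2 := by
    intro s t h1 h2 h3 h4
    rw [staircase_sub hα hfin h2]
    exact ENNReal.toReal_le_of_le_ofReal (by linarith) (h s t h1 h2 h3 h4)
  refine ⟨min δ 1, by positivity, fun y hy => ?_⟩
  rw [Real.dist_eq, lt_min_iff, abs_lt, abs_lt] at hy
  rw [Real.dist_eq, abs_lt]
  rcases le_total x y with hxy | hxy
  · have h1 := hbd x y (by linarith) hxy (by linarith) (by linarith)
    have h2 := staircase_mono (l := l) hα hfin hxy
    constructor <;> linarith
  · have h1 := hbd y x (by linarith) hxy (by linarith) (by linarith)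
    have h2 := staircase_mono (l := l) hα hfin hxy
    constructor <;> linarith

theorem inter_Icc_nonempty_of_staircase_lt (hα : 0 < α)
    (hfin : ∀ x y : ℝ, x ≤ y → massFunction F α x y ≠ ∞) (hxy : x ≤ y)
    (h : staircase F α l x < staircase F α l y) : (F ∩ Set.Icc x y).Nonempty := by
  by_contra hF
  have := staircase_sub (l := l) hα hfin hxy
  rw [massFunction_eq_zero_of_disjoint hxy hF] at this
  simp at this
  linarith

end Staircase

/-! ### Reduction of fractal integrals to ordinary ones by `u = S(t)`. -/

section Integral

variable {F : Set ℝ} {α l x y : ℝ} {g : ℝ → ℝ}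

theorem bddAbove_image_comp_staircase (hα : 0 < α)
    (hfin : ∀ x y : ℝ, x ≤ y → massFunction F α x y ≠ ∞) (hg : Continuous g) (x y : ℝ) :
    BddAbove ((fun t => g (staircase F α l t)) '' (F ∩ Set.Icc x y)) :=
  (isCompact_Icc.bddAbove_image (hg.comp (staircase_continuous hα hfin)).continuousOn).mono
    (Set.image_mono Set.inter_subset_right)

theorem bddBelow_image_comp_staircase (hα : 0 < α)
    (hfin : ∀ x y : ℝ, x ≤ y → massFunction F α x y ≠ ∞) (hg : Continuous g) (x y : ℝ) :
    BddBelow ((fun t => g (staircase F α l t)) '' (F ∩ Set.Icc x y)) :=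
  (isCompact_Icc.bddBelow_image (hg.comp (staircase_continuous hα hfin)).continuousOn).mono
    (Set.image_mono Set.inter_subset_right)

/-- The values of `S` on `F ∩ [x, y]` are dense in `(S x, S y)`: between two nearby values `S`
increases, hence meets `F`. By continuity of `g`, the supremum over `F` alone bounds `g` on that
whole open interval. If `S x = S y` the interval is empty and nothing is required of the supremum.
-/
theorem integral_le_sSup_mul (hα : 0 < α)
    (hfin : ∀ x y : ℝ, x ≤ y → massFunction F α x y ≠ ∞) (hg : Continuous g) (hxy : x ≤ y) :
    ∫ u in staircase F α l x..staircase F α l y, g u ≤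
      sSup ((fun t => g (staircase F α l t)) '' (F ∩ Set.Icc x y)) *
        (staircase F α l y - staircase F α l x) := by
  set S := staircase F α l
  have hmono : Monotone S := staircase_mono hα hfin
  have hcont : Continuous S := staircase_continuous hα hfin
  set M := sSup ((fun t => g (S t)) '' (F ∩ Set.Icc x y))
  have hle : ∀ r ∈ Set.Ioo (S x) (S y), g r ≤ M := by
    intro r hr
    by_contra! hM
    obtain ⟨d, hd, hball⟩ := Metric.mem_nhds_iff.1
      (inter_mem (hg.continuousAt.eventually (lt_mem_nhds hM)) (Ioo_mem_nhds hr.1 hr.2))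
    have hin : ∀ r', |r' - r| < d → M < g r' ∧ r' ∈ Set.Ioo (S x) (S y) :=
      fun r' h => hball (by rwa [Metric.mem_ball, Real.dist_eq])
    have h1 := hin (r - d / 2) (by rw [abs_lt]; constructor <;> linarith)
    have h2 := hin (r + d / 2) (by rw [abs_lt]; constructor <;> linarith)
    obtain ⟨t₁, ht₁, hS₁⟩ := intermediate_value_Icc hxy hcont.continuousOn
      (Set.Ioo_subset_Icc_self h1.2)
    obtain ⟨t₂, ht₂, hS₂⟩ := intermediate_value_Icc hxy hcont.continuousOn
      (Set.Ioo_subset_Icc_self h2.2)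
    have hlt : S t₁ < S t₂ := by rw [hS₁, hS₂]; linarith
    have ht : t₁ < t₂ := hmono.reflect_lt hlt
    obtain ⟨p, hpF, hp⟩ := inter_Icc_nonempty_of_staircase_lt hα hfin ht.le hlt
    have hp1 := hmono hp.1
    have hp2 := hmono hp.2
    have h3 := hin (S p) (by rw [abs_lt]; constructor <;> linarith)
    exact (le_csSup (bddAbove_image_comp_staircase hα hfin hg x y)
      ⟨p, ⟨hpF, ht₁.1.trans hp.1, hp.2.trans ht₂.2⟩, rfl⟩).not_gt h3.1
  calc ∫ u in S x..S y, g u ≤ ∫ _ in S x..S y, M :=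
        intervalIntegral.integral_mono_on_of_le_Ioo (hmono hxy) (hg.intervalIntegrable _ _)
          intervalIntegrable_const hle
    _ = M * (S y - S x) := by simp [mul_comm]

theorem sInf_mul_le_integral (hα : 0 < α)
    (hfin : ∀ x y : ℝ, x ≤ y → massFunction F α x y ≠ ∞) (hg : Continuous g) (hxy : x ≤ y) :
    sInf ((fun t => g (staircase F α l t)) '' (F ∩ Set.Icc x y)) *
        (staircase F α l y - staircase F α l x) ≤
      ∫ u in staircase F α l x..staircase F α l y, g u := by
  have h := integral_le_sSup_mul (l := l) hα hfin hg.neg hxy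
  simp only [Pi.neg_apply] at h
  have himg : (fun t => -g (staircase F α l t)) '' (F ∩ Set.Icc x y) =
      -((fun t => g (staircase F α l t)) '' (F ∩ Set.Icc x y)) := by
    rw [← Set.image_neg_eq_neg, Set.image_image]
  rw [himg, intervalIntegral.integral_neg] at h
  rw [Real.sInf_def]
  linarith

/-- The default value `0` on empty sets does no harm: if `F` misses `[x, y]`, the increment of `S`
is `0`. -/
theorem sSup_sub_sInf_image_mul_le {f : ℝ → ℝ} (hα : 0 < α)
    (hfin : ∀ x y : ℝ, x ≤ y → massFunction F α x y ≠ ∞) (hxy : x ≤ y) {ε : ℝ}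
    (hf : ∀ p ∈ Set.Icc x y, ∀ q ∈ Set.Icc x y, f p ≤ f q + ε) :
    sSup (f '' (F ∩ Set.Icc x y)) * (staircase F α l y - staircase F α l x) ≤
      sInf (f '' (F ∩ Set.Icc x y)) * (staircase F α l y - staircase F α l x) +
        ε * (staircase F α l y - staircase F α l x) := by
  rcases (staircase_mono (l := l) hα hfin hxy).eq_or_lt with h | h
  · simp [h]
  · have hne := (inter_Icc_nonempty_of_staircase_lt hα hfin hxy h).image f
    rw [← add_mul]
    refine mul_le_mul_of_nonneg_right ?_ (by linarith)
    refine csSup_le hne ?_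
    rintro _ ⟨p, hp, rfl⟩
    rw [← sub_le_iff_le_add]
    refine le_csInf hne ?_
    rintro _ ⟨q, hq, rfl⟩
    have := hf p hp.2 q hq.2
    linarith

theorem Subdivision.sum_integral_comp (P : Subdivision x y) (hg : Continuous g) (S : ℝ → ℝ) :
    ∑ i ∈ Finset.range P.n, ∫ u in S (P.pt i)..S (P.pt (i + 1)), g u = ∫ u in S x..S y, g u := by
  rw [intervalIntegral.sum_integral_adjacent_intervals (a := fun i => S (P.pt i))
    (fun i _ => hg.intervalIntegrable _ _), P.pt_zero, P.pt_last]

/-- Each lower sum lies below, and each upper sum above, the ordinary integral; uniform continuity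
of `g ∘ S` on `[x, y]` makes their difference at most `ε (S y - S x)` on a fine enough mesh. -/
theorem hasFractalIntegral_comp_staircase (hα : 0 < α)
    (hfin : ∀ x y : ℝ, x ≤ y → massFunction F α x y ≠ ∞) (hg : Continuous g) (hxy : x ≤ y) :
    HasFractalIntegral F α l (fun t => g (staircase F α l t)) x y
      (∫ u in staircase F α l x..staircase F α l y, g u) := by
  set S := staircase F α l with hS
  have hlow : ∀ P : Subdivision x y, P.lowerSum F α l (fun t => g (S t)) ≤
      ∫ u in S x..S y, g u := fun P => by
    rw [← P.sum_integral_comp hg S]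
    exact Finset.sum_le_sum fun i hi =>
      sInf_mul_le_integral hα hfin hg (P.lt_succ i (Finset.mem_range.1 hi)).le
  have hupp : ∀ P : Subdivision x y, ∫ u in S x..S y, g u ≤
      P.upperSum F α l (fun t => g (S t)) := fun P => by
    rw [← P.sum_integral_comp hg S]
    exact Finset.sum_le_sum fun i hi =>
      integral_le_sSup_mul hα hfin hg (P.lt_succ i (Finset.mem_range.1 hi)).le
  have hfine : ∀ ε > 0, ∃ P : Subdivision x y, P.upperSum F α l (fun t => g (S t)) ≤
      P.lowerSum F α l (fun t => g (S t)) + ε * (S y - S x) := by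
    intro ε hε
    have hcont : Continuous fun t => g (S t) := hg.comp (staircase_continuous hα hfin)
    obtain ⟨δ, hδ, huc⟩ := Metric.uniformContinuousOn_iff_le.1
      (isCompact_Icc.uniformContinuousOn_of_continuous (hcont.continuousOn (s := Set.Icc x y)))
      ε hε
    obtain ⟨P, hP⟩ := Subdivision.exists_meshLE hxy hδ
    refine ⟨P, ?_⟩
    have htel : ∑ i ∈ Finset.range P.n, ε * (S (P.pt (i + 1)) - S (P.pt i)) =
        ε * (S y - S x) := by
      rw [← Finset.mul_sum, Finset.sum_range_sub (fun i => S (P.pt i)), P.pt_zero, P.pt_last]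
    rw [← htel, Subdivision.upperSum, Subdivision.lowerSum, ← Finset.sum_add_distrib]
    refine Finset.sum_le_sum fun i hi => ?_
    have hi := Finset.mem_range.1 hi
    refine sSup_sub_sInf_image_mul_le hα hfin (P.lt_succ i hi).le fun p hp q hq => ?_
    have hsub : Set.Icc (P.pt i) (P.pt (i + 1)) ⊆ Set.Icc x y :=
      Set.Icc_subset_Icc (P.pt_mem hi.le).1 (P.pt_mem hi).2
    have hd : dist p q ≤ δ := (Real.dist_le_of_mem_Icc hp hq).trans (hP i hi)
    have := huc p (hsub hp) q (hsub hq) hd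
    rw [Real.dist_eq, abs_le] at this
    linarith [this.2]
  have hsmall : ∀ C D : ℝ, (∀ ε > 0, C ≤ D + ε * (S y - S x)) → C ≤ D := by
    intro C D h
    have hc : Continuous fun ε : ℝ => D + ε * (S y - S x) := by fun_prop
    have ht := (hc.tendsto 0).mono_left (nhdsWithin_le_nhds (s := Set.Ioi 0))
    simp only [zero_mul, add_zero] at ht
    exact ge_of_tendsto ht (by filter_upwards [self_mem_nhdsWithin] with ε hε using h ε hε)
  refine ⟨bddAbove_image_comp_staircase hα hfin hg x y,
    bddBelow_image_comp_staircase hα hfin hg x y, ⟨?_, ?_⟩, ⟨?_, ?_⟩⟩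
  · rintro _ ⟨P, rfl⟩
    exact hlow P
  · intro M hM
    refine hsmall _ _ fun ε hε => ?_
    obtain ⟨P, hP⟩ := hfine ε hε
    have := hM ⟨P, rfl⟩
    simp only at this
    linarith [hupp P]
  · rintro _ ⟨P, rfl⟩
    exact hupp P
  · intro M hM
    refine hsmall _ _ fun ε hε => ?_
    obtain ⟨P, hP⟩ := hfine ε hε
    have := hM ⟨P, rfl⟩
    simp only at this
    linarith [hlow P]

theorem HasFractalIntegral.unique {f : ℝ → ℝ} {I J : ℝ} (hI : HasFractalIntegral F α l f x y I)
    (hJ : HasFractalIntegral F α l f x y J) : I = J :=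
  hI.2.2.1.unique hJ.2.2.1

theorem HasFractalImproperIntegral.unique {f : ℝ → ℝ} {I J : ℝ}
    (hI : HasFractalImproperIntegral F α l f I) (hJ : HasFractalImproperIntegral F α l f J) :
    I = J := by
  obtain ⟨G, hG, hGI⟩ := hI
  obtain ⟨H, hH, hHJ⟩ := hJ
  refine tendsto_nhds_unique (hGI.congr' ?_) hHJ
  filter_upwards [eventually_ge_atTop 0] with b hb using (hG b hb).unique (hH b hb)

theorem HasFractalImproperIntegral.fractalImproperIntegral_eq {f : ℝ → ℝ} {I : ℝ}
    (hI : HasFractalImproperIntegral F α l f I) : fractalImproperIntegral F α l f = I := by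
  have h : ∃ I, HasFractalImproperIntegral F α l f I := ⟨I, hI⟩
  rw [fractalImproperIntegral, dif_pos h]
  exact h.choose_spec.unique hI

/-- Going back from limits in `S(b)` to limits in `b` is composition with `S → ∞`. The other
direction needs every `B ≥ 0` to be a value `S(b)` with `b ≥ 0`; `S` may have plateaus, but `S(b) >
S(N)` still gives `b > N`. -/
theorem hasFractalImproperIntegral_comp_staircase_iff (hα : 0 < α)
    (hfin : ∀ x y : ℝ, x ≤ y → massFunction F α x y ≠ ∞) (hzero : staircase F α l 0 = 0)
    (htop : Tendsto (staircase F α l) atTop atTop) (hg : Continuous g) {I : ℝ} :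
    HasFractalImproperIntegral F α l (fun t => g (staircase F α l t)) I ↔
      Tendsto (fun B => ∫ u in (0 : ℝ)..B, g u) atTop (𝓝 I) := by
  have hint : ∀ b, 0 ≤ b → HasFractalIntegral F α l (fun t => g (staircase F α l t)) 0 b
      (∫ u in (0 : ℝ)..staircase F α l b, g u) := fun b hb => by
    simpa only [hzero] using hasFractalIntegral_comp_staircase (l := l) hα hfin hg hb
  constructor
  · rintro ⟨G, hG, hGI⟩
    have hcont : Continuous (staircase F α l) := staircase_continuous hα hfin
    have hsurj : ∀ B, 0 ≤ B → ∃ b, 0 ≤ b ∧ staircase F α l b = B := by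
      intro B hB
      obtain ⟨c, hc, hc0⟩ := ((htop.eventually_ge_atTop B).and (eventually_ge_atTop 0)).exists
      obtain ⟨b, hb, hbB⟩ := intermediate_value_Icc hc0 hcont.continuousOn
        (show B ∈ Set.Icc (staircase F α l 0) (staircase F α l c) from ⟨by rwa [hzero], hc⟩)
      exact ⟨b, hb.1, hbB⟩
    rw [Metric.tendsto_atTop] at hGI ⊢
    intro ε hε
    obtain ⟨N, hN⟩ := hGI ε hε
    refine ⟨max 0 (staircase F α l N) + 1, fun B hB => ?_⟩
    have h0 := le_max_left 0 (staircase F α l N)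
    have h1 := le_max_right 0 (staircase F α l N)
    obtain ⟨b, hb, rfl⟩ := hsurj B (by linarith)
    have hNb : N < b := (staircase_mono (l := l) hα hfin).reflect_lt (by linarith)
    rw [← (hG b hb).unique (hint b hb)]
    exact hN b hNb.le
  · intro h
    exact ⟨_, hint, h.comp htop⟩

theorem fractalGamma_eq_Gamma (hα : 0 < α)
    (hfin : ∀ x y : ℝ, x ≤ y → massFunction F α x y ≠ ∞) (hzero : staircase F α l 0 = 0)
    (htop : Tendsto (staircase F α l) atTop atTop) {s : ℝ} (hs : 1 ≤ s) :
    fractalGamma F α l s = Real.Gamma s := by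
  have hg : Continuous fun u : ℝ => Real.exp (-u) * u ^ (s - 1) :=
    (Real.continuous_exp.comp continuous_neg).mul (Real.continuous_rpow_const (by linarith))
  refine HasFractalImproperIntegral.fractalImproperIntegral_eq
    ((hasFractalImproperIntegral_comp_staircase_iff hα hfin hzero htop hg).2 ?_)
  rw [Real.Gamma_eq_integral (by linarith)]
  exact MeasureTheory.intervalIntegral_tendsto_integral_Ioi 0
    (Real.GammaIntegral_convergent (by linarith)) tendsto_id

end Integral

/-! ### Volterra equations and convolutions on the half-line. -/

section Volterra

open MeasureTheory

/-- A solution of a Volterra equation with a non-increasing power kernel stays positive: if `T`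
were its first zero, then `y t ≤ μ * ∫_t^T (T - s)^(β - 1) y s` for all `t < T`, which fails where
`y` attains its maximum on a short interval `[T - δ, T]`. -/
theorem volterra_pos {β μ : ℝ} (hβ : 0 < β) (hβ1 : β ≤ 1) (hμ : 0 ≤ μ) {y : ℝ → ℝ}
    (hy : Continuous y)
    (heq : ∀ x, 0 ≤ x → y x = 1 - μ * ∫ s in (0 : ℝ)..x, (x - s) ^ (β - 1) * y s)
    {x : ℝ} (hx : 0 ≤ x) : 0 < y x := by
  by_contra! hneg
  have hker : ∀ T a b : ℝ, IntervalIntegrable (fun s => (T - s) ^ (β - 1)) volume a b := by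
    intro T a b
    have := (intervalIntegral.intervalIntegrable_rpow' (a := T - a) (b := T - b)
      (by linarith : -1 < β - 1)).comp_sub_left T
    simpa using this
  have hint : ∀ T a b : ℝ, IntervalIntegrable (fun s => (T - s) ^ (β - 1) * y s) volume a b :=
    fun T a b => (hker T a b).mul_continuousOn hy.continuousOn
  have hy0 : y 0 = 1 := by simpa using heq 0 le_rfl
  set Z : Set ℝ := Set.Ici 0 ∩ y ⁻¹' Set.Iic 0 with hZ
  have hZne : Z.Nonempty := ⟨x, hx, hneg⟩
  have hZbdd : BddBelow Z := ⟨0, fun t ht => ht.1⟩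
  have hZcl : IsClosed Z := isClosed_Ici.inter (isClosed_Iic.preimage hy)
  set T := sInf Z
  have hTZ : T ∈ Z := hZcl.csInf_mem hZne hZbdd
  have hT0 : 0 ≤ T := hTZ.1
  have hyT : y T ≤ 0 := hTZ.2
  have hTpos : 0 < T := by
    refine lt_of_le_of_ne hT0 fun h => ?_
    rw [← h, hy0] at hyT
    linarith
  have hpos : ∀ t, 0 ≤ t → t < T → 0 < y t := by
    intro t h0 hlt
    by_contra! h
    exact (csInf_le hZbdd (show t ∈ Z from ⟨h0, h⟩)).not_gt hlt
  have hmain : ∀ t, 0 ≤ t → t < T → y t ≤ μ * ∫ s in t..T, (T - s) ^ (β - 1) * y s := by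
    intro t h0 hlt
    have hsplit := intervalIntegral.integral_add_adjacent_intervals (hint T 0 t) (hint T t T)
    have h1 := heq T hT0
    have h2 := heq t h0
    -- Since `β ≤ 1`, the kernel does not increase when `t` is replaced by `T`; `y` is positive on
    -- the range of integration.
    have hmono : ∫ s in (0 : ℝ)..t, (T - s) ^ (β - 1) * y s ≤
        ∫ s in (0 : ℝ)..t, (t - s) ^ (β - 1) * y s := by
      refine intervalIntegral.integral_mono_on_of_le_Ioo h0 (hint T 0 t) (hint t 0 t)
        fun s hs => ?_
      refine mul_le_mul_of_nonneg_right ?_ (hpos s hs.1.le (hs.2.trans hlt)).le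
      exact Real.rpow_le_rpow_of_nonpos (by linarith [hs.2]) (by linarith) (by linarith)
    have h3 := mul_le_mul_of_nonneg_left hmono hμ
    rw [← hsplit, mul_add] at h1
    linarith
  have hev : ∀ᶠ δ in 𝓝[>] (0 : ℝ), μ * (δ ^ β / β) < 1 := by
    have hc : Continuous fun δ : ℝ => μ * (δ ^ β / β) :=
      continuous_const.mul ((Real.continuous_rpow_const hβ.le).div_const _)
    have := hc.tendsto 0
    simp only [Real.zero_rpow hβ.ne', zero_div, mul_zero] at this
    exact (this.mono_left nhdsWithin_le_nhds).eventually_lt_const one_pos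
  obtain ⟨δ, hδ1, hδ0, hδT⟩ := (hev.and (Ioo_mem_nhdsGT hTpos)).exists
  obtain ⟨t, ht, htmax⟩ := isCompact_Icc.exists_isMaxOn
    (Set.nonempty_Icc.2 (by linarith : T - δ ≤ T)) hy.continuousOn
  have hyt : 0 < y t := (hpos (T - δ) (by linarith) (by linarith)).trans_le
    (htmax (Set.left_mem_Icc.2 (by linarith)))
  have htT : t < T := lt_of_le_of_ne ht.2 fun h => by rw [h] at hyt; linarith
  have hb : ∫ s in t..T, (T - s) ^ (β - 1) * y s ≤ (δ ^ β / β) * y t := by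
    calc ∫ s in t..T, (T - s) ^ (β - 1) * y s
        ≤ ∫ s in t..T, (T - s) ^ (β - 1) * y t := by
          refine intervalIntegral.integral_mono_on_of_le_Ioo htT.le (hint T t T)
            ((hker T t T).mul_const _) fun s hs => ?_
          refine mul_le_mul_of_nonneg_left ?_ (Real.rpow_nonneg (by linarith [hs.2]) _)
          exact htmax ⟨ht.1.trans hs.1.le, hs.2.le⟩
      _ = ((T - t) ^ β / β) * y t := by
          rw [intervalIntegral.integral_mul_const,
            intervalIntegral.integral_comp_sub_left (fun r => r ^ (β - 1)),
            integral_rpow (Or.inl (by linarith))]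
          simp [Real.zero_rpow hβ.ne']
      _ ≤ (δ ^ β / β) * y t := by
          have : (0 : ℝ) ≤ T - t := by linarith
          have : T - t ≤ δ := by linarith [ht.1]
          gcongr
  have h1 := hmain t (by linarith [ht.1]) htT
  have h2 := mul_le_mul_of_nonneg_left hb hμ
  have h3 := mul_lt_mul_of_pos_right hδ1 hyt
  linarith

/-- Integrating a convolution over `(0, X]`. -/
theorem integral_convolution_eq {k h : ℝ → ℝ} (hk : IntegrableOn k (Set.Ioi 0))
    (hh : Continuous h) {X : ℝ} (hX : 0 ≤ X) :
    ∫ x in (0 : ℝ)..X, ∫ s in (0 : ℝ)..x, k (x - s) * h s =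
      ∫ r in Set.Ioi (0 : ℝ), k r * ∫ s in (0 : ℝ)..max (X - r) 0, h s := by
  -- The cut-off `r < x` encodes the triangle of integration. On `(0, X] × (0, ∞)` the factor `K` is
  -- bounded by the maximum of `|h|` on `[0, X]`, so integrability of `k` suffices for Fubini.
  set K : ℝ × ℝ → ℝ := {p : ℝ × ℝ | p.2 < p.1}.indicator fun p => h (p.1 - p.2) with hK
  have hKmeas : Measurable K :=
    Measurable.indicator (by fun_prop) (measurableSet_lt measurable_snd measurable_fst)
  obtain ⟨C, hC⟩ := (isCompact_Icc (a := (0 : ℝ)) (b := X)).exists_bound_of_continuousOn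
    hh.continuousOn
  have hC0 : 0 ≤ C := (norm_nonneg _).trans (hC 0 ⟨le_rfl, hX⟩)
  have hint : Integrable (fun p : ℝ × ℝ => k p.2 * K p)
      ((volume.restrict (Set.Ioc 0 X)).prod (volume.restrict (Set.Ioi 0))) := by
    refine Integrable.mul_bdd (c := C) (hk.integrable.comp_snd _) hKmeas.aestronglyMeasurable ?_
    rw [Measure.prod_restrict]
    filter_upwards [ae_restrict_mem (measurableSet_Ioc.prod measurableSet_Ioi)] with p hp
    by_cases hlt : p.2 < p.1
    · have h2 : (0 : ℝ) < p.2 := hp.2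
      have h1 : p.1 ≤ X := hp.1.2
      rw [hK, Set.indicator_of_mem (show p ∈ {p : ℝ × ℝ | p.2 < p.1} from hlt)]
      exact hC _ ⟨by linarith, by linarith⟩
    · rw [hK, Set.indicator_of_notMem (show p ∉ {p : ℝ × ℝ | p.2 < p.1} from hlt), norm_zero]
      exact hC0
  have hswap := integral_integral_swap (f := fun x r => k r * K (x, r)) hint
  rw [intervalIntegral.integral_of_le hX]
  refine Eq.trans (setIntegral_congr_fun measurableSet_Ioc fun x hx => ?_)
    (hswap.trans (setIntegral_congr_fun measurableSet_Ioi fun r hr => ?_))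
  · have hind : ∀ r, k r * K (x, r) = (Set.Iio x).indicator (fun r => k r * h (x - r)) r := by
      intro r
      by_cases hr : r < x <;> simp [hK, Set.indicator, hr]
    simp only [hind]
    rw [setIntegral_indicator measurableSet_Iio, Set.Ioi_inter_Iio,
      ← integral_Ioc_eq_integral_Ioo, ← intervalIntegral.integral_of_le hx.1.le]
    have := intervalIntegral.integral_comp_sub_left (a := 0) (b := x)
      (fun r => k r * h (x - r)) x
    simpa using this
  · have hr : (0 : ℝ) < r := hr
    have hind : ∀ x, K (x, r) = (Set.Ioi r).indicator (fun x => h (x - r)) x := by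
      intro x
      by_cases hx : r < x <;> simp [hK, Set.indicator, hx]
    simp only [hind]
    rw [integral_const_mul, setIntegral_indicator measurableSet_Ioi, Set.Ioc_inter_Ioi,
      max_eq_right hr.le]
    congr 1
    rcases le_total r X with hrX | hrX
    · rw [← intervalIntegral.integral_of_le hrX, intervalIntegral.integral_comp_sub_right,
        sub_self, max_eq_left (by linarith)]
    · rw [Set.Ioc_eq_empty (by simpa using hrX), max_eq_right (by linarith)]
      simp

/-- If the primitive of `h` converges, then so does its convolution with an integrable kernel. -/
theorem tendsto_integral_mul_primitive {k h : ℝ → ℝ} (hk : IntegrableOn k (Set.Ioi 0))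
    (hh : Continuous h) {I : ℝ} (hI : Tendsto (fun X => ∫ s in (0 : ℝ)..X, h s) atTop (𝓝 I)) :
    Tendsto (fun X => ∫ r in Set.Ioi (0 : ℝ), k r * ∫ s in (0 : ℝ)..max (X - r) 0, h s) atTop
      (𝓝 ((∫ r in Set.Ioi (0 : ℝ), k r) * I)) := by
  set Y : ℝ → ℝ := fun X => ∫ s in (0 : ℝ)..X, h s with hY
  have hYc : Continuous Y :=
    intervalIntegral.continuous_primitive (fun a b => hh.intervalIntegrable a b) 0
  -- A convergent continuous primitive is bounded on `[0, ∞)`; this gives the dominating function `C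
  -- |k|`, and no absolute integrability of `h` is needed.
  obtain ⟨C, hC⟩ : ∃ C, ∀ t, 0 ≤ t → ‖Y t‖ ≤ C := by
    obtain ⟨N, hN⟩ := eventually_atTop.1 (hI.norm.eventually_lt_const (lt_add_one ‖I‖))
    obtain ⟨C, hC⟩ := (isCompact_Icc (a := (0 : ℝ)) (b := N)).exists_bound_of_continuousOn
      hYc.continuousOn
    refine ⟨max C (‖I‖ + 1), fun t ht => ?_⟩
    rcases le_total t N with h | h
    · exact (hC t ⟨ht, h⟩).trans (le_max_left _ _)
    · exact (hN t h).le.trans (le_max_right _ _)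
  rw [← integral_mul_const]
  refine tendsto_integral_filter_of_dominated_convergence (fun r => ‖k r‖ * C) ?_ ?_
    (hk.norm.mul_const C) ?_
  · refine Eventually.of_forall fun X => hk.aestronglyMeasurable.mul ?_
    exact (hYc.comp (by fun_prop : Continuous fun r : ℝ => max (X - r) 0)).aestronglyMeasurable
  · refine Eventually.of_forall fun X => Eventually.of_forall fun r => ?_
    rw [norm_mul]
    exact mul_le_mul_of_nonneg_left (hC _ (le_max_right _ _)) (norm_nonneg _)
  · refine Eventually.of_forall fun r => Tendsto.const_mul _ (hI.comp ?_)
    exact tendsto_atTop_mono (fun X => le_max_left _ _)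
      (tendsto_atTop_add_const_right _ (-r) tendsto_id)

end Volterra

/-! ### The classical Mittag-Leffler function and its Laplace-type integral. -/

section MittagLeffler

open MeasureTheory

/-- The classical Mittag-Leffler function `E_β(z) = ∑_j z^j / Γ(β j + 1)`. -/
noncomputable def mittagLeffler (β z : ℝ) : ℝ :=
  ∑' j : ℕ, z ^ j / Real.Gamma (β * j + 1)

/-- Restrict the Gamma integral to `(A, ∞)`, where `x^(s - 1) ≥ A^(s - 1)`. As `A` is free, Gamma
outgrows every geometric sequence, which is all that convergence of the series requires. -/
theorem rpow_mul_exp_neg_le_Gamma {A s : ℝ} (hA : 0 < A) (hs : 1 ≤ s) :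
    A ^ (s - 1) * Real.exp (-A) ≤ Real.Gamma s := by
  have hconv := Real.GammaIntegral_convergent (by linarith : 0 < s)
  rw [Real.Gamma_eq_integral (by linarith), ← integral_exp_neg_Ioi, ← integral_const_mul]
  calc ∫ x in Set.Ioi A, A ^ (s - 1) * Real.exp (-x)
      ≤ ∫ x in Set.Ioi A, Real.exp (-x) * x ^ (s - 1) := by
        refine setIntegral_mono_on ((integrableOn_exp_neg_Ioi A).const_mul _)
          (hconv.mono_set (Set.Ioi_subset_Ioi hA.le)) measurableSet_Ioi fun x hx => ?_
        have hx : A < x := hx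
        rw [mul_comm]
        have : A ^ (s - 1) ≤ x ^ (s - 1) := Real.rpow_le_rpow hA.le hx.le (by linarith)
        gcongr
    _ ≤ ∫ x in Set.Ioi 0, Real.exp (-x) * x ^ (s - 1) := by
        refine setIntegral_mono_set hconv ?_ (Set.Ioi_subset_Ioi hA.le).eventuallyLE
        filter_upwards [ae_restrict_mem measurableSet_Ioi] with x hx
        have hx : (0 : ℝ) < x := hx
        positivity

variable {β : ℝ}

theorem Gamma_mul_add_one_pos (hβ : 0 < β) (j : ℕ) : 0 < Real.Gamma (β * j + 1) :=
  Real.Gamma_pos_of_pos (by positivity)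

theorem summable_mittagLeffler (hβ : 0 < β) (z : ℝ) :
    Summable fun j : ℕ => z ^ j / Real.Gamma (β * j + 1) := by
  -- With `A^β > |z|`, the series is dominated by a geometric one of ratio `|z| / A^β < 1`.
  obtain ⟨A, hAz, hA⟩ := (((tendsto_rpow_atTop hβ).eventually_gt_atTop |z|).and
    (eventually_gt_atTop 0)).exists
  have hAβ : 0 < A ^ β := Real.rpow_pos_of_pos hA _
  have hgeo : Summable fun j : ℕ => Real.exp A * (|z| / A ^ β) ^ j :=
    (summable_geometric_of_lt_one (by positivity) ((div_lt_one hAβ).2 hAz)).mul_left _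
  refine hgeo.of_norm_bounded fun j => ?_
  have hG := rpow_mul_exp_neg_le_Gamma hA (s := β * j + 1) (by
    have : 0 ≤ β * j := by positivity
    linarith)
  rw [add_sub_cancel_right, Real.rpow_mul hA.le, Real.rpow_natCast] at hG
  rw [norm_div, norm_pow, Real.norm_eq_abs, Real.norm_of_nonneg (Gamma_mul_add_one_pos hβ j).le]
  calc |z| ^ j / Real.Gamma (β * j + 1) ≤ |z| ^ j / ((A ^ β) ^ j * Real.exp (-A)) := by gcongr
    _ = Real.exp A * (|z| / A ^ β) ^ j := by
        rw [Real.exp_neg, div_pow]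
        field_simp

theorem continuous_mittagLeffler (hβ : 0 < β) : Continuous (mittagLeffler β) := by
  refine continuous_iff_continuousAt.2 fun z => ?_
  have h : ContinuousOn (mittagLeffler β) (Metric.ball 0 (|z| + 1)) := by
    refine continuousOn_tsum (fun j => by fun_prop) (summable_mittagLeffler hβ (|z| + 1))
      fun j w hw => ?_
    have hG := Gamma_mul_add_one_pos hβ j
    rw [mem_ball_zero_iff] at hw
    rw [norm_div, norm_pow, Real.norm_of_nonneg hG.le]
    gcongr
  exact h.continuousAt (Metric.isOpen_ball.mem_nhds (by simp))

theorem mittagLeffler_zero : mittagLeffler β 0 = 1 := by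
  rw [mittagLeffler, tsum_eq_single 0 (fun j hj => by simp [hj])]
  simp

theorem mittagLeffler_nonneg (hβ : 0 < β) {z : ℝ} (hz : 0 ≤ z) : 0 ≤ mittagLeffler β z :=
  tsum_nonneg fun j => div_nonneg (pow_nonneg hz j) (Gamma_mul_add_one_pos hβ j).le

theorem abs_mittagLeffler_le (hβ : 0 < β) (z : ℝ) : |mittagLeffler β z| ≤ mittagLeffler β |z| := by
  rw [← Real.norm_eq_abs]
  refine tsum_of_norm_bounded (f := fun j : ℕ => z ^ j / Real.Gamma (β * j + 1))
    (summable_mittagLeffler hβ |z|).hasSum fun j => ?_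
  rw [norm_div, norm_pow, Real.norm_eq_abs, Real.norm_of_nonneg (Gamma_mul_add_one_pos hβ j).le]

theorem integral_sub_rpow_mul_rpow {p q x : ℝ} (hp : 0 < p) (hq : 0 < q) (hx : 0 < x) :
    ∫ s in (0 : ℝ)..x, (x - s) ^ (q - 1) * s ^ (p - 1) =
      x ^ (p + q - 1) * (Real.Gamma p * Real.Gamma q / Real.Gamma (p + q)) := by
  have h := Complex.betaIntegral_scaled p q hx
  rw [Complex.betaIntegral_eq_Gamma_mul_div _ _ (by simpa) (by simpa)] at h
  rw [← Complex.ofReal_inj, ← intervalIntegral.integral_ofReal]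
  calc ∫ s in (0 : ℝ)..x, (((x - s) ^ (q - 1) * s ^ (p - 1) : ℝ) : ℂ)
      = ∫ s in (0 : ℝ)..x, (s : ℂ) ^ ((p : ℂ) - 1) * ((x : ℂ) - s) ^ ((q : ℂ) - 1) := by
        refine intervalIntegral.integral_congr fun s hs => ?_
        rw [Set.uIcc_of_le hx.le] at hs
        rw [mul_comm]
        push_cast [Complex.ofReal_cpow hs.1, Complex.ofReal_cpow (sub_nonneg.2 hs.2)]
        rfl
    _ = _ := by
        rw [h]
        push_cast [Complex.ofReal_cpow hx.le, ← Complex.Gamma_ofReal]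
        rfl

/-- `x ↦ E_β(-lam x^β)` solves a Volterra equation with kernel `r^(β - 1) / Γ(β)`. -/
theorem mittagLeffler_volterra (hβ : 0 < β) (lam : ℝ) {x : ℝ} (hx : 0 ≤ x) :
    mittagLeffler β (-lam * x ^ β) = 1 - lam / Real.Gamma β *
      ∫ s in (0 : ℝ)..x, (x - s) ^ (β - 1) * mittagLeffler β (-lam * s ^ β) := by
  rcases hx.eq_or_lt with rfl | hx
  · simp [Real.zero_rpow hβ.ne', mittagLeffler_zero]
  have hGβ : 0 < Real.Gamma β := Real.Gamma_pos_of_pos hβ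
  have hker : IntervalIntegrable (fun s => (x - s) ^ (β - 1)) volume 0 x := by
    have := (intervalIntegral.intervalIntegrable_rpow' (a := x) (b := 0)
      (by linarith : -1 < β - 1)).comp_sub_left x
    simpa using this
  -- The series is integrated term by term; on `(0, x]` the bound `s^β ≤ x^β` gives a summable
  -- majorant.
  have hsum := intervalIntegral.hasSum_integral_of_dominated_convergence (μ := volume)
    (a := 0) (b := x)
    (F := fun (j : ℕ) s => (x - s) ^ (β - 1) * ((-lam * s ^ β) ^ j / Real.Gamma (β * j + 1)))
    (f := fun s => (x - s) ^ (β - 1) * mittagLeffler β (-lam * s ^ β))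
    (fun j s => (x - s) ^ (β - 1) * ((|lam| * x ^ β) ^ j / Real.Gamma (β * j + 1)))
    (fun j => by
      refine Measurable.aestronglyMeasurable ?_
      fun_prop)
    (fun j => Eventually.of_forall fun s hs => by
      rw [Set.uIoc_of_le hx.le] at hs
      have hG := Gamma_mul_add_one_pos hβ j
      have h0 : 0 ≤ s := hs.1.le
      have h1 : 0 ≤ x - s := sub_nonneg.2 hs.2
      have h2 : s ^ β ≤ x ^ β := Real.rpow_le_rpow h0 hs.2 hβ.le
      have h3 : 0 ≤ s ^ β := Real.rpow_nonneg h0 _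
      rw [norm_mul, Real.norm_of_nonneg (Real.rpow_nonneg h1 _), norm_div, norm_pow, norm_mul,
        norm_neg, Real.norm_of_nonneg h3, Real.norm_of_nonneg hG.le, Real.norm_eq_abs]
      have h4 := Real.rpow_nonneg h1 (β - 1)
      gcongr)
    (Eventually.of_forall fun s _ => (summable_mittagLeffler hβ _).mul_left _)
    (by simpa only [tsum_mul_left] using hker.mul_const _)
    (Eventually.of_forall fun s _ => (summable_mittagLeffler hβ _).hasSum.mul_left _)
  -- By the Beta integral, the kernel sends the term of index `j` to a multiple of the term of index
  -- `j + 1`; the missing term of index `0` is the constant `1` of the equation.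
  have hterm : ∀ j : ℕ, ∫ s in (0 : ℝ)..x,
      (x - s) ^ (β - 1) * ((-lam * s ^ β) ^ j / Real.Gamma (β * j + 1)) =
      Real.Gamma β * x ^ β * ((-lam * x ^ β) ^ j / Real.Gamma (β * (j + 1 : ℕ) + 1)) := by
    intro j
    have hG := Gamma_mul_add_one_pos hβ j
    have hp : 0 < β * j + 1 := by positivity
    have h := integral_sub_rpow_mul_rpow hp hβ hx
    have hpow : ∀ s : ℝ, 0 ≤ s → (s ^ β) ^ j = s ^ (β * j + 1 - 1) := fun s hs => by
      rw [add_sub_cancel_right, Real.rpow_mul hs, Real.rpow_natCast]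
    calc ∫ s in (0 : ℝ)..x, (x - s) ^ (β - 1) * ((-lam * s ^ β) ^ j / Real.Gamma (β * j + 1))
        = ∫ s in (0 : ℝ)..x, ((-lam) ^ j / Real.Gamma (β * j + 1)) *
            ((x - s) ^ (β - 1) * s ^ (β * j + 1 - 1)) := by
          refine intervalIntegral.integral_congr fun s hs => ?_
          rw [Set.uIcc_of_le hx.le] at hs
          rw [mul_pow, hpow s hs.1]
          ring
      _ = _ := by
          rw [intervalIntegral.integral_const_mul, h, mul_pow, hpow x hx.le,
            show β * (j + 1 : ℕ) + 1 = β * j + 1 + β by push_cast; ring,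
            show β * j + 1 + β - 1 = (β * j + 1 - 1) + β by ring, Real.rpow_add hx]
          field_simp
  simp only [hterm] at hsum
  have hzero := (summable_mittagLeffler hβ (-lam * x ^ β)).tsum_eq_zero_add
  rw [← hsum.tsum_eq, tsum_mul_left, mittagLeffler, hzero]
  have hshift : ∀ j : ℕ, (-lam * x ^ β) ^ (j + 1) / Real.Gamma (β * (j + 1 : ℕ) + 1) =
      (-lam * x ^ β) * ((-lam * x ^ β) ^ j / Real.Gamma (β * (j + 1 : ℕ) + 1)) := fun j => by
    rw [pow_succ]; ring
  simp only [hshift, tsum_mul_left]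
  simp only [pow_zero, Nat.cast_zero, mul_zero, zero_add, Real.Gamma_one, div_one]
  field_simp
  ring

theorem continuous_mittagLeffler_rpow (hβ : 0 < β) (lam : ℝ) :
    Continuous fun x : ℝ => mittagLeffler β (-lam * x ^ β) :=
  (continuous_mittagLeffler hβ).comp
    (continuous_const.mul (Real.continuous_rpow_const hβ.le))

/-- The density `e^{-r} r^{β - 1} / Γ(β)`. -/
noncomputable def gammaKernel (β r : ℝ) : ℝ := Real.exp (-r) * r ^ (β - 1) / Real.Gamma β

theorem integrableOn_gammaKernel (hβ : 0 < β) : IntegrableOn (gammaKernel β) (Set.Ioi 0) :=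
  (Real.GammaIntegral_convergent hβ).div_const _

theorem integral_gammaKernel (hβ : 0 < β) : ∫ r in Set.Ioi (0 : ℝ), gammaKernel β r = 1 := by
  simp only [gammaKernel]
  rw [integral_div, ← Real.Gamma_eq_integral hβ, div_self (Real.Gamma_pos_of_pos hβ).ne']

theorem gammaKernel_nonneg (hβ : 0 < β) {r : ℝ} (hr : 0 < r) : 0 ≤ gammaKernel β r := by
  have := Real.Gamma_pos_of_pos hβ
  unfold gammaKernel
  positivity

theorem continuous_exp_mul_mittagLeffler (hβ : 0 < β) (lam : ℝ) :
    Continuous fun x : ℝ => Real.exp (-x) * mittagLeffler β (-lam * x ^ β) :=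
  (Real.continuous_exp.comp continuous_neg).mul (continuous_mittagLeffler_rpow hβ lam)

theorem intervalIntegrable_exp_neg (a b : ℝ) :
    IntervalIntegrable (fun x : ℝ => Real.exp (-x)) volume a b :=
  (Real.continuous_exp.comp continuous_neg).intervalIntegrable a b

theorem integral_exp_neg_eq (X : ℝ) : ∫ x in (0 : ℝ)..X, Real.exp (-x) = 1 - Real.exp (-X) := by
  rw [intervalIntegral.integral_comp_neg, integral_exp]
  simp

/-- Writing `e^{-x} = e^{-(x - s)} e^{-s}` turns the Volterra equation into one with kernel
`gammaKernel`; integrating over `[0, X]` and exchanging the integrals gives an equation for the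
primitive alone. -/
theorem integral_exp_mul_mittagLeffler (hβ : 0 < β) (lam : ℝ) {X : ℝ} (hX : 0 ≤ X) :
    ∫ x in (0 : ℝ)..X, Real.exp (-x) * mittagLeffler β (-lam * x ^ β) =
      1 - Real.exp (-X) - lam * ∫ r in Set.Ioi (0 : ℝ), gammaKernel β r *
        ∫ s in (0 : ℝ)..max (X - r) 0, Real.exp (-s) * mittagLeffler β (-lam * s ^ β) := by
  have hc := continuous_exp_mul_mittagLeffler hβ lam
  rw [← integral_convolution_eq (integrableOn_gammaKernel hβ) hc hX, ← integral_exp_neg_eq]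
  have hpt : ∀ x ∈ Set.uIcc 0 X, lam * ∫ s in (0 : ℝ)..x, gammaKernel β (x - s) *
      (Real.exp (-s) * mittagLeffler β (-lam * s ^ β)) =
      Real.exp (-x) - Real.exp (-x) * mittagLeffler β (-lam * x ^ β) := by
    intro x hx
    rw [Set.uIcc_of_le hX] at hx
    have hpoint : ∀ s, gammaKernel β (x - s) *
        (Real.exp (-s) * mittagLeffler β (-lam * s ^ β)) = Real.exp (-x) / Real.Gamma β *
        ((x - s) ^ (β - 1) * mittagLeffler β (-lam * s ^ β)) := by
      intro s
      rw [gammaKernel, show -x = -(x - s) + -s by ring, Real.exp_add]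
      ring
    simp only [hpoint]
    rw [intervalIntegral.integral_const_mul, mittagLeffler_volterra hβ lam hx.1]
    ring
  rw [← intervalIntegral.integral_const_mul, intervalIntegral.integral_congr hpt,
    intervalIntegral.integral_sub
      (intervalIntegrable_exp_neg _ _)
      (hc.intervalIntegrable _ _)]
  ring

theorem limit_integral_exp_mul_mittagLeffler (hβ : 0 < β) {lam I : ℝ}
    (hI : Tendsto (fun X => ∫ x in (0 : ℝ)..X, Real.exp (-x) * mittagLeffler β (-lam * x ^ β))
      atTop (𝓝 I)) : (1 + lam) * I = 1 := by
  have hconv := tendsto_integral_mul_primitive (integrableOn_gammaKernel hβ)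
    (continuous_exp_mul_mittagLeffler hβ lam) hI
  rw [integral_gammaKernel hβ, one_mul] at hconv
  have hexp : Tendsto (fun X : ℝ => 1 - Real.exp (-X)) atTop (𝓝 (1 - 0)) :=
    tendsto_const_nhds.sub (Real.tendsto_exp_atBot.comp tendsto_neg_atTop_atBot)
  have hlim := hexp.sub (hconv.const_mul lam)
  have := tendsto_nhds_unique (hI.congr' (by
    filter_upwards [eventually_ge_atTop 0] with X hX
    exact integral_exp_mul_mittagLeffler hβ lam hX)) hlim
  linarith

/-- Replacing `lam` by `-|lam|` gives a majorant `H ≥ 0` with increasing primitive `Y`. As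
`gammaKernel` has mass `1`, its average of `Y((X - r)⁺)` is at most `Y(X)`, so the renewal equation
gives `(1 - |lam|) Y(X) ≤ 1`. -/
theorem integrableOn_exp_mul_mittagLeffler_of_abs_lt (hβ : 0 < β) {lam : ℝ} (hlam : |lam| < 1) :
    IntegrableOn (fun x : ℝ => Real.exp (-x) * mittagLeffler β (-lam * x ^ β)) (Set.Ioi 0) := by
  set H : ℝ → ℝ := fun x => Real.exp (-x) * mittagLeffler β (- -|lam| * x ^ β) with hH
  have hHc : Continuous H := continuous_exp_mul_mittagLeffler hβ _
  have hHint : ∀ a b, IntervalIntegrable H volume a b := fun a b => hHc.intervalIntegrable a b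
  have hH0 : ∀ x, 0 ≤ x → 0 ≤ H x := fun x hx =>
    mul_nonneg (Real.exp_pos _).le (mittagLeffler_nonneg hβ
      (by rw [neg_neg]; exact mul_nonneg (abs_nonneg _) (Real.rpow_nonneg hx _)))
  set Y : ℝ → ℝ := fun X => ∫ x in (0 : ℝ)..X, H x with hY
  have hYmono : ∀ s t, 0 ≤ s → s ≤ t → Y s ≤ Y t := by
    intro s t hs hst
    have := intervalIntegral.integral_add_adjacent_intervals (hHint 0 s) (hHint s t)
    have h0 : 0 ≤ ∫ x in s..t, H x :=
      intervalIntegral.integral_nonneg hst fun x hx => hH0 x (hs.trans hx.1)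
    simp only [hY]
    linarith
  have hYc : Continuous Y := intervalIntegral.continuous_primitive hHint 0
  have hY00 : Y 0 = 0 := by simp [hY]
  have hbound : ∀ X, 0 ≤ X → Y X ≤ 1 / (1 - |lam|) := by
    intro X hX
    have h := integral_exp_mul_mittagLeffler hβ (-|lam|) hX
    have hYX : 0 ≤ Y X := by rw [← hY00]; exact hYmono 0 X le_rfl hX
    have hle : ∫ r in Set.Ioi (0 : ℝ), gammaKernel β r * Y (max (X - r) 0) ≤ Y X := by
      calc ∫ r in Set.Ioi (0 : ℝ), gammaKernel β r * Y (max (X - r) 0)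
          ≤ ∫ r in Set.Ioi (0 : ℝ), gammaKernel β r * Y X := by
            have hYle : ∀ r, 0 < r → Y (max (X - r) 0) ≤ Y X := fun r hr =>
              hYmono _ _ (le_max_right _ _) (max_le (by linarith) hX)
            refine setIntegral_mono_on ?_ ((integrableOn_gammaKernel hβ).mul_const _)
              measurableSet_Ioi fun r hr =>
                mul_le_mul_of_nonneg_left (hYle r hr) (gammaKernel_nonneg hβ hr)
            refine Integrable.mul_bdd (c := Y X) (integrableOn_gammaKernel hβ) ?_ ?_
            · exact (hYc.comp
                (by fun_prop : Continuous fun r : ℝ => max (X - r) 0)).aestronglyMeasurable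
            · filter_upwards [ae_restrict_mem measurableSet_Ioi] with r hr
              rw [Real.norm_of_nonneg]
              · exact hYle r hr
              · exact hY00.symm.le.trans (hYmono _ _ le_rfl (le_max_right _ _))
        _ = Y X := by rw [integral_mul_const, integral_gammaKernel hβ, one_mul]
    have h2 := mul_le_mul_of_nonneg_left hle (abs_nonneg lam)
    have h3 := Real.exp_pos (-X)
    rw [le_div_iff₀ (by linarith)]
    change Y X = 1 - Real.exp (-X) - -|lam| *
      ∫ r in Set.Ioi (0 : ℝ), gammaKernel β r * Y (max (X - r) 0) at h
    linarith
  have hHI : IntegrableOn H (Set.Ioi 0) := by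
    refine integrableOn_Ioi_of_intervalIntegral_norm_bounded (1 / (1 - |lam|)) 0
      (fun X => (hHint 0 X).1) tendsto_id ?_
    filter_upwards [eventually_ge_atTop 0] with X hX
    refine le_trans (le_of_eq ?_) (hbound X hX)
    refine intervalIntegral.integral_congr fun x hx => ?_
    rw [Set.uIcc_of_le hX] at hx
    exact Real.norm_of_nonneg (hH0 x hx.1)
  refine Integrable.mono' hHI
    (continuous_exp_mul_mittagLeffler hβ lam).aestronglyMeasurable ?_
  filter_upwards [ae_restrict_mem measurableSet_Ioi] with x hx
  have hx : (0 : ℝ) < x := hx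
  rw [norm_mul, Real.norm_of_nonneg (Real.exp_pos _).le, Real.norm_eq_abs]
  refine mul_le_mul_of_nonneg_left ((abs_mittagLeffler_le hβ _).trans (le_of_eq ?_))
    (Real.exp_pos _).le
  rw [abs_mul, abs_neg, abs_of_nonneg (Real.rpow_nonneg hx.le _), neg_neg]

theorem mittagLeffler_pos (hβ : 0 < β) (hβ1 : β ≤ 1) {lam : ℝ} (hlam : 0 ≤ lam) {x : ℝ}
    (hx : 0 ≤ x) : 0 < mittagLeffler β (-lam * x ^ β) :=
  volterra_pos hβ hβ1 (div_nonneg hlam (Real.Gamma_pos_of_pos hβ).le)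
    (continuous_mittagLeffler_rpow hβ lam) (fun _ hx => mittagLeffler_volterra hβ lam hx) hx

theorem mittagLeffler_le_one (hβ : 0 < β) (hβ1 : β ≤ 1) {lam : ℝ} (hlam : 0 ≤ lam) {x : ℝ}
    (hx : 0 ≤ x) : mittagLeffler β (-lam * x ^ β) ≤ 1 := by
  rw [mittagLeffler_volterra hβ lam hx, sub_le_self_iff]
  refine mul_nonneg (div_nonneg hlam (Real.Gamma_pos_of_pos hβ).le)
    (intervalIntegral.integral_nonneg hx fun s hs => ?_)
  exact mul_nonneg (Real.rpow_nonneg (sub_nonneg.2 hs.2) _)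
    (mittagLeffler_pos hβ hβ1 hlam hs.1).le

theorem integrableOn_exp_mul_mittagLeffler_of_nonneg (hβ : 0 < β) (hβ1 : β ≤ 1) {lam : ℝ}
    (hlam : 0 ≤ lam) :
    IntegrableOn (fun x : ℝ => Real.exp (-x) * mittagLeffler β (-lam * x ^ β)) (Set.Ioi 0) := by
  refine Integrable.mono' (integrableOn_exp_neg_Ioi 0)
    (continuous_exp_mul_mittagLeffler hβ lam).aestronglyMeasurable ?_
  filter_upwards [ae_restrict_mem measurableSet_Ioi] with x hx
  have hx : (0 : ℝ) ≤ x := le_of_lt hx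
  rw [Real.norm_of_nonneg (mul_nonneg (Real.exp_pos _).le (mittagLeffler_pos hβ hβ1 hlam hx).le)]
  exact mul_le_of_le_one_right (Real.exp_pos _).le (mittagLeffler_le_one hβ hβ1 hlam hx)

end MittagLeffler

/-! ### The Sumudu transform as an ordinary integral, and the lemma. -/

section Sumudu

variable {F : Set ℝ} {α l : ℝ}

/-- The rescaling `u = S(v) x` absorbs the prefactor `1 / S(v)` and normalises the exponential. -/
theorem hasFractalSumudu_comp_staircase_iff (hα : 0 < α)
    (hfin : ∀ x y : ℝ, x ≤ y → massFunction F α x y ≠ ∞) (hzero : staircase F α l 0 = 0)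
    (htop : Tendsto (staircase F α l) atTop atTop) {g : ℝ → ℝ} (hg : Continuous g) {v c : ℝ}
    (hv : 0 < staircase F α l v) :
    HasFractalSumudu F α l (fun t => g (staircase F α l t)) v c ↔
      Tendsto (fun X => ∫ x in (0 : ℝ)..X, Real.exp (-x) * g (staircase F α l v * x)) atTop
        (𝓝 c) := by
  set w := staircase F α l v
  have hgw : Continuous fun u => Real.exp (-(u / w)) * g u := by fun_prop
  have hsub : ∀ B, ∫ u in (0 : ℝ)..B, Real.exp (-(u / w)) * g u =
      w * ∫ x in (0 : ℝ)..B / w, Real.exp (-x) * g (w * x) := by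
    intro B
    have := intervalIntegral.integral_comp_div (a := 0) (b := B)
      (fun x => Real.exp (-x) * g (w * x)) hv.ne'
    simpa only [mul_div_cancel₀ _ hv.ne', zero_div, smul_eq_mul] using this
  have hiff : ∀ I, HasFractalImproperIntegral F α l
      (fun t => Real.exp (-(staircase F α l t / w)) * g (staircase F α l t)) I ↔
      Tendsto (fun X => ∫ x in (0 : ℝ)..X, Real.exp (-x) * g (w * x)) atTop (𝓝 (1 / w * I)) := by
    intro I
    rw [hasFractalImproperIntegral_comp_staircase_iff hα hfin hzero htop hgw]
    simp only [hsub]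
    constructor
    · intro h
      have := (h.comp (tendsto_id.atTop_mul_const hv)).const_mul (1 / w)
      simpa only [Function.comp_def, id_eq, mul_div_cancel_right₀ _ hv.ne', ← mul_assoc,
        one_div, inv_mul_cancel₀ hv.ne', one_mul] using this
    · intro h
      have := (h.comp (tendsto_id.atTop_div_const hv)).const_mul w
      simpa only [Function.comp_def, id_eq, ← mul_assoc, one_div, mul_inv_cancel₀ hv.ne',
        one_mul] using this
  constructor
  · rintro ⟨I, hI, rfl⟩
    exact (hiff I).1 hI
  · intro h
    have hc : 1 / w * (w * c) = c := by field_simp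
    exact ⟨w * c, (hiff _).2 (by rwa [hc]), hc.symm⟩

theorem mittagLefflerNegPow_eq (hα : 0 < α)
    (hfin : ∀ x y : ℝ, x ≤ y → massFunction F α x y ≠ ∞) (hzero : staircase F α l 0 = 0)
    (htop : Tendsto (staircase F α l) atTop atTop) {β : ℝ} (hβ : 0 < β) (a t : ℝ) :
    mittagLefflerNegPow F α l a β t = mittagLeffler β (-a * staircase F α l t ^ β) := by
  refine tsum_congr fun j => ?_
  rw [fractalGamma_eq_Gamma hα hfin hzero htop]
  have : 0 ≤ β * j := by positivity
  linarith

end Sumudu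

theorem lemma2p16 (F : Set ℝ) (α l : ℝ) (hα0 : 0 < α) (hα1 : α ≤ 1)
    (hfin : ∀ x y : ℝ, x ≤ y → massFunction F α x y ≠ ∞)
    (hzero : staircase F α l 0 = 0)
    (htop : Tendsto (staircase F α l) atTop atTop)
    (a β : ℝ) (hβ : 0 < β) (v : ℝ) (hv : 0 < staircase F α l v) :
    -- the two transforms exist, with the stated values
    ((0 ≤ a ∧ β ≤ 1 ∨ |a| * staircase F α l v ^ β < 1) →
      HasFractalSumudu F α l (fun t => mittagLefflerNegPow F α l a β t) v
        (1 / (1 + a * staircase F α l v ^ β)) ∧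
      HasFractalSumudu F α l (fun t => 1 - mittagLefflerNegPow F α l a β t) v
        (a * staircase F α l v ^ β / (1 + a * staircase F α l v ^ β))) ∧
    -- whenever one of the transforms exists, it has the stated value
    (∀ c : ℝ, HasFractalSumudu F α l (fun t => mittagLefflerNegPow F α l a β t) v c →
      1 + a * staircase F α l v ^ β ≠ 0 ∧ c = 1 / (1 + a * staircase F α l v ^ β)) ∧
    (∀ c : ℝ, HasFractalSumudu F α l (fun t => 1 - mittagLefflerNegPow F α l a β t) v c →
      1 + a * staircase F α l v ^ β ≠ 0 ∧
        c = a * staircase F α l v ^ β / (1 + a * staircase F α l v ^ β)) := by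
  have hEc : Continuous fun u : ℝ => mittagLeffler β (-a * u ^ β) :=
    continuous_mittagLeffler_rpow hβ a
  simp only [mittagLefflerNegPow_eq hα0 hfin hzero htop hβ]
  have hiff₁ := fun c : ℝ =>
    hasFractalSumudu_comp_staircase_iff (c := c) hα0 hfin hzero htop hEc hv
  have hiff₂ := fun c : ℝ =>
    hasFractalSumudu_comp_staircase_iff (c := c) hα0 hfin hzero htop
      (g := fun u => 1 - mittagLeffler β (-a * u ^ β)) (continuous_const.sub hEc) hv
  simp only [hiff₁, hiff₂]
  set w := staircase F α l v
  set lam := a * w ^ β with hlam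
  set Y : ℝ → ℝ := fun X =>
    ∫ x in (0 : ℝ)..X, Real.exp (-x) * mittagLeffler β (-lam * x ^ β) with hY
  have hscale : ∀ x, 0 ≤ x → -a * (w * x) ^ β = -lam * x ^ β := fun x hx => by
    rw [Real.mul_rpow hv.le hx, hlam]; ring
  have hY₁ : (fun X => ∫ x in (0 : ℝ)..X, Real.exp (-x) * mittagLeffler β (-a * (w * x) ^ β))
      =ᶠ[atTop] Y := by
    filter_upwards [eventually_ge_atTop 0] with X hX
    refine intervalIntegral.integral_congr fun x hx => ?_
    rw [Set.uIcc_of_le hX] at hx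
    simp only [hscale x hx.1]
  -- The two truncated transforms add up to `1 - e^{-X}`, which converges, so either one converges
  -- exactly when the other does, and their limits add up to `1`.
  have hY₂ : (fun X => ∫ x in (0 : ℝ)..X,
      Real.exp (-x) * (1 - mittagLeffler β (-a * (w * x) ^ β)))
      =ᶠ[atTop] fun X => 1 - Real.exp (-X) - Y X := by
    filter_upwards [eventually_ge_atTop 0] with X hX
    rw [← integral_exp_neg_eq, hY, ← intervalIntegral.integral_sub
      (intervalIntegrable_exp_neg _ _)
      ((continuous_exp_mul_mittagLeffler hβ lam).intervalIntegrable _ _)]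
    refine intervalIntegral.integral_congr fun x hx => ?_
    rw [Set.uIcc_of_le hX] at hx
    simp only [hscale x hx.1]
    ring
  have hexp : Tendsto (fun X : ℝ => 1 - Real.exp (-X)) atTop (𝓝 1) := by
    simpa using tendsto_const_nhds.sub (Real.tendsto_exp_atBot.comp tendsto_neg_atTop_atBot)
  have hvalue : ∀ c, Tendsto Y atTop (𝓝 c) → 1 + lam ≠ 0 ∧ c = 1 / (1 + lam) := by
    intro c hc
    have h := limit_integral_exp_mul_mittagLeffler hβ hc
    have hne : 1 + lam ≠ 0 := left_ne_zero_of_mul_eq_one h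
    exact ⟨hne, by rw [eq_div_iff hne, mul_comm, h]⟩
  refine ⟨fun hcase => ?_, fun c hc => hvalue c (hc.congr' hY₁), fun c hc => ?_⟩
  · have hint : MeasureTheory.IntegrableOn
        (fun x : ℝ => Real.exp (-x) * mittagLeffler β (-lam * x ^ β)) (Set.Ioi 0) := by
      have hw : 0 ≤ w ^ β := Real.rpow_nonneg hv.le _
      rcases hcase with ⟨ha, hβ1⟩ | h
      · exact integrableOn_exp_mul_mittagLeffler_of_nonneg hβ hβ1 (mul_nonneg ha hw)
      · refine integrableOn_exp_mul_mittagLeffler_of_abs_lt hβ ?_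
        rwa [hlam, abs_mul, abs_of_nonneg hw]
    have hlim := MeasureTheory.intervalIntegral_tendsto_integral_Ioi 0 hint tendsto_id
    obtain ⟨hne, heq⟩ := hvalue _ hlim
    rw [heq] at hlim
    refine ⟨hlim.congr' hY₁.symm, ?_⟩
    have h := (hexp.sub hlim).congr' hY₂.symm
    rwa [show 1 - 1 / (1 + lam) = lam / (1 + lam) by field_simp; ring] at h
  · have h := hexp.sub (hc.congr' hY₂)
    simp only [sub_sub_cancel] at h
    obtain ⟨hne, heq⟩ := hvalue _ h
    refine ⟨hne, ?_⟩
    rw [show c = 1 - 1 / (1 + lam) by linarith]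
    field_simp
    ring
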